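/- Let $N\ge 1$, let $L^2=L^2((0,1)^N)$ (complex valued), and let $H^1(T^N)$ be the Sobolev space of the torus $T^N=\mathbb R^N/\mathbb Z^N$, regarded as a subspace of $H^1((0,1)^N)$ that contains $H^1_0((0,1)^N)$. Let $H^1_m(T^N)$ be the subspace of those $u\in H^1(T^N)$ with $\int_{(0,1)^N}u\,dx=0$. Let $$\mathrm{Har}((0,1)^N)=\Big\{u\in H^1((0,1)^N):\int_{(0,1)^N}\nabla u\cdot\overline{\nabla v}\,dx=0\ \ \forall v\in H^1_0((0,1)^N)\Big\},$$ and define $\mathrm{Har}(T^N)$ in the same way with $H^1(T^N)$ in place of $H^1((0,1)^N)$. Let $V_1$ be the closure of $\mathrm{Har}((0,1)^N)$ in $L^2$, and let $V=\{f\in L^2:(f|g)_{L^2}=0\ \forall g\in \mathrm{Har}((0,1)^N)\}$. Let $H^{-1}(T^N)$ and $H^{-1}((0,1)^N)$ be the spaces of bounded conjugate-linear functionals on $H^1(T^N)$ and on $H^1_0((0,1)^N)$, with $L^2$ embedded in $H^{-1}(T^N)$ by $\langle h,v\rangle=\int h\bar v\,dx$. Let $H\subset H^{-1}(T^N)$ be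 the annihilator of $\mathrm{Har}(T^N)$, and let $\mathrm{Id}_m:H\to H^{-1}((0,1)^N)$ be the restriction to $H$ of the projection of $H^{-1}(T^N)=H^{-1}((0,1)^N)\oplus \mathrm{Har}(T^N)'$ onto the first summand, that is, $\mathrm{Id}_m w=w|_{H^1_0((0,1)^N)}$. For $f\in H^{-1}(T^N)$ let $u_f\in H^1_m(T^N)$ be the solution of $\operatorname{div}\nabla u_f=f-\langle f,1\rangle$, that is, of $$\int_{(0,1)^N}\nabla u_f\cdot\overline{\nabla v}\,dx=-\langle f,v\rangle\qquad\forall v\in H^1_m(T^N).$$ Let $A$ be the operator in $H$ associated with the form $a(f,h)=\int_{(0,1)^N} f\bar h\,dx$ with form domain $V$: $$D(A)=\Big\{f\in V:\exists g\in H:\ a(f,h)=\int_{(0,1)^N}\nabla u_g\cdot\overline{\nabla u_h}\,dx\ \ \forall h\in V\Big\},\qquad Af=g.$$ **Theorem.** These objects are well defined: $u_f$ exists and is unique for every $f\in H^{-1}(T^N)$, the map $\mathrm{Id}_m$ is bijective, and for every $f\in D(A)$ the element $g$ is unique. Moreover $$D(A)=V\cap\big(H^1_m(T^N)+V_1\big),$$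 and for every $f\in D(A)$ the distributional Laplacian $\Delta f$ belongs to $H^{-1}((0,1)^N)$ and $$Af=-\mathrm{Id}_m^{-1}\Delta f .$$ -/

import Mathlib

open MeasureTheory TopologicalSpace Set
open scoped ContDiff Distributions ComplexConjugate

noncomputable section

namespace CubeHeat

/-! ### The cube, test functions, partial derivatives -/

/-- The open unit cube `(0,1)^N`, a fundamental domain of the torus `T^N = ℝ^N / ℤ^N`. -/
def cube (N : ℕ) : Opens (Fin N → ℝ) :=
  ⟨Set.univ.pi fun _ => Ioo (0 : ℝ) 1, isOpen_set_pi finite_univ fun _ _ => isOpen_Ioo⟩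

/-- Lebesgue measure on `(0,1)^N`. -/
abbrev cubeMeasure (N : ℕ) : Measure (Fin N → ℝ) :=
  (volume : Measure (Fin N → ℝ)).restrict (cube N : Set (Fin N → ℝ))

/-- The complex Hilbert space `L²((0,1)^N)`, which is also `L²(T^N)`. -/
abbrev L2 (N : ℕ) : Type := Lp ℂ 2 (cubeMeasure N)

/-- The partial derivative `∂φ/∂x_j`. -/
def pd {N : ℕ} (j : Fin N) (φ : (Fin N → ℝ) → ℂ) : (Fin N → ℝ) → ℂ :=
  fun x => fderiv ℝ φ x (Pi.single j 1)

/-- The classical Laplacian `∑_j ∂²φ/∂x_j²`. -/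
def classicalLaplacian {N : ℕ} (φ : (Fin N → ℝ) → ℂ) : (Fin N → ℝ) → ℂ :=
  fun x => ∑ j, pd j (pd j φ) x

/-- The test functions on the cube: smooth, with compact support in `(0,1)^N`. -/
def cubeTests (N : ℕ) : Set ((Fin N → ℝ) → ℂ) :=
  range fun (φ : 𝓓(cube N, ℂ)) => (φ : (Fin N → ℝ) → ℂ)

/-- The test functions on the torus: smooth functions on `ℝ^N` with period `1` in each variable. -/
def torusTests (N : ℕ) : Set ((Fin N → ℝ) → ℂ) :=
  {φ | ContDiff ℝ ∞ φ ∧ ∀ (x : Fin N → ℝ) (j : Fin N), φ (x + Pi.single j 1) = φ x}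

theorem cubeTests_contDiff {N : ℕ} : ∀ φ ∈ cubeTests N, ContDiff ℝ ∞ φ := by
  rintro _ ⟨φ, rfl⟩
  exact φ.contDiff

theorem torusTests_contDiff {N : ℕ} : ∀ φ ∈ torusTests N, ContDiff ℝ ∞ φ := fun _ h => h.1

theorem contDiff_pd {N : ℕ} {φ : (Fin N → ℝ) → ℂ} (h : ContDiff ℝ ∞ φ) (j : Fin N) :
    ContDiff ℝ ∞ (pd j φ) :=
  (h.fderiv_right (m := ∞) (by simp)).clm_apply contDiff_const

theorem cube_subset_Icc (N : ℕ) : (cube N : Set (Fin N → ℝ)) ⊆ Icc 0 1 := by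
  intro x hx
  have hx' : ∀ i, x i ∈ Ioo (0 : ℝ) 1 := fun i => hx i (mem_univ i)
  exact ⟨fun i => (hx' i).1.le, fun i => (hx' i).2.le⟩

instance (N : ℕ) : IsFiniteMeasure (cubeMeasure N) :=
  ⟨by
    rw [Measure.restrict_apply_univ]
    exact (measure_mono (cube_subset_Icc N)).trans_lt isCompact_Icc.measure_lt_top⟩

theorem memLp_cube {N : ℕ} {φ : (Fin N → ℝ) → ℂ} (h : Continuous φ) :
    MemLp φ 2 (cubeMeasure N) := by
  obtain ⟨C, hC⟩ := (isCompact_Icc (a := (0 : Fin N → ℝ)) (b := 1)).exists_bound_of_continuousOn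
    h.continuousOn
  refine MemLp.of_bound h.aestronglyMeasurable C ?_
  filter_upwards [ae_restrict_mem (cube N).isOpen.measurableSet] with x hx
  exact hC x (cube_subset_Icc N hx)

theorem integrable_mul_cube {N : ℕ} (f : L2 N) {φ : (Fin N → ℝ) → ℂ} (h : Continuous φ) :
    Integrable (fun x => f x * φ x) (cubeMeasure N) :=
  (Lp.memLp f).integrable_mul (memLp_cube h)

/-- The `L²`-class of a continuous function. -/
def toL2 {N : ℕ} (φ : (Fin N → ℝ) → ℂ) (h : Continuous φ) : L2 N := (memLp_cube h).toLp φ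

theorem inner_toL2_conj {N : ℕ} (f : L2 N) {φ : (Fin N → ℝ) → ℂ} (h : Continuous φ) :
    inner ℂ (toL2 (fun x => conj (φ x)) (Complex.continuous_conj.comp h)) f =
      ∫ x in cube N, f x * φ x := by
  rw [L2.inner_def]
  refine integral_congr_ae ?_
  filter_upwards [(memLp_cube (N := N) (Complex.continuous_conj.comp h)).coeFn_toLp] with x hx
  have : (toL2 (fun x => conj (φ x)) (Complex.continuous_conj.comp h) : L2 N) x = conj (φ x) := hx
  rw [this]
  simp

/-! ### Sobolev spaces

A Sobolev function is recorded as the pair of the function and its weak gradient. All the spaces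
are subspaces of the Hilbert space of pairs, whose norm restricts to the `H¹`-norm. -/

/-- Pairs `(u, p)` with `u ∈ L²` and `p ∈ (L²)^N`, with `‖(u, p)‖² = ‖u‖² + ∑_j ‖p_j‖²`. -/
abbrev Pairs (N : ℕ) : Type := WithLp 2 (L2 N × PiLp 2 fun _ : Fin N => L2 N)

/-- The pairs `(u, p)` for which `p` is the weak gradient of `u` with respect to the class `T` of
test functions: `∫ u ∂_jφ = - ∫ p_j φ` for all `φ ∈ T` and all `j`. -/
def weakGradientPairs {N : ℕ} (T : Set ((Fin N → ℝ) → ℂ)) (hT : ∀ φ ∈ T, ContDiff ℝ ∞ φ) :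
    Submodule ℂ (Pairs N) where
  carrier := {e | ∀ φ ∈ T, ∀ j : Fin N,
    ∫ x in cube N, e.fst x * pd j φ x = - ∫ x in cube N, e.snd j x * φ x}
  zero_mem' := by
    intro φ hφ j
    rw [← inner_toL2_conj _ (contDiff_pd (hT φ hφ) j).continuous,
      ← inner_toL2_conj _ (hT φ hφ).continuous]
    simp
  add_mem' := by
    intro a b ha hb φ hφ j
    have ha' := ha φ hφ j
    have hb' := hb φ hφ j
    rw [← inner_toL2_conj _ (contDiff_pd (hT φ hφ) j).continuous,
      ← inner_toL2_conj _ (hT φ hφ).continuous] at ha' hb' ⊢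
    simp only [WithLp.add_fst, WithLp.add_snd, PiLp.add_apply, inner_add_right, ha', hb']
    ring
  smul_mem' := by
    intro c a ha φ hφ j
    have ha' := ha φ hφ j
    rw [← inner_toL2_conj _ (contDiff_pd (hT φ hφ) j).continuous,
      ← inner_toL2_conj _ (hT φ hφ).continuous] at ha' ⊢
    simp only [WithLp.smul_fst, WithLp.smul_snd, PiLp.smul_apply, inner_smul_right, ha']
    ring

/-- `H¹((0,1)^N)`. -/
def H1cube (N : ℕ) : Submodule ℂ (Pairs N) := weakGradientPairs (cubeTests N) cubeTests_contDiff

/-- `H¹(T^N)`: weak derivatives are taken on the torus, i.e. against smooth periodic functions. -/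
def H1torus (N : ℕ) : Submodule ℂ (Pairs N) := weakGradientPairs (torusTests N) torusTests_contDiff

/-- The pair `(φ, ∇φ)` of a smooth function `φ`. -/
def gradPair {N : ℕ} (φ : (Fin N → ℝ) → ℂ) (h : ContDiff ℝ ∞ φ) : Pairs N :=
  WithLp.toLp 2 (toL2 φ h.continuous,
    WithLp.toLp 2 fun j => toL2 (pd j φ) (contDiff_pd h j).continuous)

/-- `H¹₀((0,1)^N)`: the closure of the test functions on the cube in the `H¹`-norm. -/
def H10 (N : ℕ) : Submodule ℂ (Pairs N) :=
  (Submodule.span ℂ (range fun φ : 𝓓(cube N, ℂ) => gradPair φ φ.contDiff)).topologicalClosure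

/-- The function underlying a pair. -/
def functionOf (N : ℕ) : Pairs N →L[ℂ] L2 N := WithLp.fstL 2 ℂ _ _

/-- The subspace of `L²` formed by the functions that underlie a space of pairs. -/
def functionsOf {N : ℕ} (K : Submodule ℂ (Pairs N)) : Submodule ℂ (L2 N) :=
  K.map (functionOf N).toLinearMap

theorem integral_cube_eq {N : ℕ} {F : (Fin N → ℝ) → ℂ} (hF : Function.support F ⊆ cube N) :
    ∫ x in cube N, F x = ∫ x, F x :=
  setIntegral_eq_integral_of_forall_compl_eq_zero fun x hx => by
    by_contra h
    exact hx (hF h)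

/-- An element of `H¹((0,1)^N)` is determined by its function: weak gradients are unique. -/
theorem H1cube_ext {N : ℕ} {e e' : Pairs N} (he : e ∈ H1cube N) (he' : e' ∈ H1cube N)
    (h : e.fst = e'.fst) : e = e' := by
  have hd : e - e' ∈ H1cube N := Submodule.sub_mem _ he he'
  have h0 : (e - e').fst = 0 := by simp [h]
  have key : ∀ d : Pairs N, d ∈ H1cube N → d.fst = 0 → ∀ j, d.snd j = 0 := by
    intro d hd h0 j
    have hz : ∀ᵐ x, x ∈ (cube N : Set (Fin N → ℝ)) → (d.snd j : (Fin N → ℝ) → ℂ) x = 0 := by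
      refine (cube N).isOpen.ae_eq_zero_of_integral_contDiff_smul_eq_zero ?_ ?_
      · exact IntegrableOn.locallyIntegrableOn ((Lp.memLp (d.snd j)).integrable (by norm_num))
      · intro g hg hgc hgs
        have hsup : tsupport (fun x => (g x : ℂ)) ⊆ tsupport g :=
          closure_mono fun x hx => by simpa using hx
        have hgC : ContDiff ℝ ∞ fun x => (g x : ℂ) := Complex.ofRealCLM.contDiff.comp hg
        have hw := hd (fun x => (g x : ℂ))
          ⟨⟨fun x => (g x : ℂ), hgC, hgc.mono' ((subset_tsupport _).trans hsup),
            hsup.trans hgs⟩, rfl⟩ j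
        rw [← inner_toL2_conj _ (contDiff_pd hgC j).continuous, h0, inner_zero_right] at hw
        have hw' := neg_eq_zero.1 hw.symm
        rw [integral_cube_eq ((Function.support_mul_subset_right _ _).trans
          (((subset_tsupport _).trans hsup).trans hgs))] at hw'
        rw [← hw']
        refine integral_congr_ae (Filter.Eventually.of_forall fun x => ?_)
        simp [mul_comm]
    refine Lp.ext ?_
    have hz' := (ae_restrict_iff' (cube N).isOpen.measurableSet).2 hz
    filter_upwards [hz', Lp.coeFn_zero ℂ 2 (cubeMeasure N)] with x hx hx0
    rw [hx, hx0]
    rfl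
  have h1 : (e - e').snd = 0 := PiLp.ext fun j => key _ hd h0 j
  have h2 : e - e' = 0 := (WithLp.equiv 2 _).injective (Prod.ext h0 h1)
  exact sub_eq_zero.1 h2

theorem isClosed_weakGradientPairs {N : ℕ} (T : Set ((Fin N → ℝ) → ℂ))
    (hT : ∀ φ ∈ T, ContDiff ℝ ∞ φ) :
    IsClosed (weakGradientPairs T hT : Set (Pairs N)) := by
  have : (weakGradientPairs T hT : Set (Pairs N)) = ⋂ (φ) (hφ : φ ∈ T) (j : Fin N),
      {e | inner ℂ (toL2 (fun x => conj (pd j φ x))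
          (Complex.continuous_conj.comp (contDiff_pd (hT φ hφ) j).continuous)) e.fst =
        - inner ℂ (toL2 (fun x => conj (φ x))
          (Complex.continuous_conj.comp (hT φ hφ).continuous)) (e.snd j)} := by
    ext e
    simp only [mem_iInter, mem_ofPred_eq]
    refine forall_congr' fun φ => forall_congr' fun hφ => forall_congr' fun j => ?_
    rw [inner_toL2_conj _ (contDiff_pd (hT φ hφ) j).continuous,
      inner_toL2_conj _ (hT φ hφ).continuous]
  rw [this]
  refine isClosed_iInter fun φ => isClosed_iInter fun hφ => isClosed_iInter fun j => ?_
  refine isClosed_eq ?_ ?_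
  · exact continuous_const.inner (WithLp.fstL 2 ℂ _ _).continuous
  · exact (continuous_const.inner ((PiLp.proj (𝕜 := ℂ) 2 (fun _ : Fin N => L2 N) j).continuous.comp
      (WithLp.sndL 2 ℂ _ _ : Pairs N →L[ℂ] _).continuous)).neg

theorem integral_toL2_mul {N : ℕ} {φ : (Fin N → ℝ) → ℂ} (h : Continuous φ)
    (ψ : (Fin N → ℝ) → ℂ) :
    ∫ x in cube N, (toL2 φ h : L2 N) x * ψ x = ∫ x in cube N, φ x * ψ x := by
  refine integral_congr_ae ?_
  filter_upwards [(memLp_cube (N := N) h).coeFn_toLp] with x hx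
  have : (toL2 φ h : L2 N) x = φ x := hx
  rw [this]

/-- A test function on the cube is also a Sobolev function on the torus, by integration by parts. -/
theorem gradPair_mem {N : ℕ} (φ : 𝓓(cube N, ℂ)) (T : Set ((Fin N → ℝ) → ℂ))
    (hT : ∀ φ ∈ T, ContDiff ℝ ∞ φ) : gradPair φ φ.contDiff ∈ weakGradientPairs T hT := by
  intro ψ hψ j
  have hφ : ContDiff ℝ ∞ (φ : (Fin N → ℝ) → ℂ) := φ.contDiff
  have hψ' := hT ψ hψ
  change ∫ x in cube N, (toL2 φ hφ.continuous : L2 N) x * pd j ψ x =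
    - ∫ x in cube N, (toL2 (pd j φ) (contDiff_pd hφ j).continuous : L2 N) x * ψ x
  rw [integral_toL2_mul, integral_toL2_mul]
  have hs : Function.support (φ : (Fin N → ℝ) → ℂ) ⊆ cube N :=
    (subset_tsupport _).trans φ.tsupport_subset
  have hs' : Function.support (pd j φ) ⊆ tsupport (φ : (Fin N → ℝ) → ℂ) := by
    intro x hx
    refine support_fderiv_subset ℝ fun h0 => hx ?_
    simp [pd, h0]
  have hcs : HasCompactSupport (pd j (φ : (Fin N → ℝ) → ℂ)) :=
    φ.hasCompactSupport.mono' hs'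
  rw [integral_cube_eq ((Function.support_mul_subset_left _ _).trans hs),
    integral_cube_eq ((Function.support_mul_subset_left _ _).trans (hs'.trans φ.tsupport_subset))]
  refine integral_mul_fderiv_eq_neg_fderiv_mul_of_integrable ?_ ?_ ?_
    (fun x _ => (hφ.differentiable (by simp)) x) (fun x _ => (hψ'.differentiable (by simp)) x)
  · exact ((contDiff_pd hφ j).continuous.mul hψ'.continuous).integrable_of_hasCompactSupport
      hcs.mul_right
  · exact (hφ.continuous.mul (contDiff_pd hψ' j).continuous).integrable_of_hasCompactSupport
      φ.hasCompactSupport.mul_right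
  · exact (hφ.continuous.mul hψ'.continuous).integrable_of_hasCompactSupport
      φ.hasCompactSupport.mul_right

/-- `H¹₀((0,1)^N)` is a subspace of `H¹(T^N)`. -/
theorem H10_le_H1torus (N : ℕ) : H10 N ≤ H1torus N :=
  Submodule.topologicalClosure_minimal _
    (Submodule.span_le.2 (by rintro _ ⟨φ, rfl⟩; exact gradPair_mem φ _ _))
    (isClosed_weakGradientPairs _ _)

/-- A test function on the cube as an element of `H¹₀((0,1)^N)`. -/
def testH10 {N : ℕ} (φ : 𝓓(cube N, ℂ)) : H10 N :=
  ⟨gradPair φ φ.contDiff,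
    Submodule.le_topologicalClosure _ (Submodule.subset_span ⟨φ, rfl⟩)⟩

/-- The Dirichlet form `∫_{(0,1)^N} ∇u · conj (∇v) dx`. -/
def gradForm {N : ℕ} (u v : Pairs N) : ℂ :=
  ∑ j, ∫ x in cube N, u.snd j x * conj (v.snd j x)

theorem gradForm_eq_inner {N : ℕ} (u v : Pairs N) : gradForm u v = inner ℂ v.snd u.snd := by
  simp only [gradForm, PiLp.inner_apply, L2.inner_def]
  rfl

/-- The members of `K` that are weakly harmonic in the cube. -/
def weaklyHarmonic {N : ℕ} (K : Submodule ℂ (Pairs N)) : Submodule ℂ (Pairs N) where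
  carrier := {u | u ∈ K ∧ ∀ v ∈ H10 N, gradForm u v = 0}
  zero_mem' := ⟨K.zero_mem, fun v _ => by simp [gradForm_eq_inner]⟩
  add_mem' := fun ha hb => ⟨K.add_mem ha.1 hb.1, fun v hv => by
    have h1 := ha.2 v hv
    have h2 := hb.2 v hv
    rw [gradForm_eq_inner] at h1 h2 ⊢
    simp [h1, h2]⟩
  smul_mem' := fun c a ha => ⟨K.smul_mem c ha.1, fun v hv => by
    have h1 := ha.2 v hv
    rw [gradForm_eq_inner] at h1 ⊢
    simp [h1]⟩

/-- `Har((0,1)^N)`, the weakly harmonic functions in `H¹((0,1)^N)`. -/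
def HarCube (N : ℕ) : Submodule ℂ (Pairs N) := weaklyHarmonic (H1cube N)

/-- `Har(T^N)`, the weakly harmonic functions in `H¹(T^N)`. -/
def HarTorus (N : ℕ) : Submodule ℂ (Pairs N) := weaklyHarmonic (H1torus N)

/-- `V₁`, the closure of `Har((0,1)^N)` in `L²((0,1)^N)`. -/
def V1 (N : ℕ) : Submodule ℂ (L2 N) := (functionsOf (HarCube N)).topologicalClosure

/-- `V = {f ∈ L² : (f|g) = 0 for all g ∈ Har((0,1)^N)}`. -/
def V (N : ℕ) : Submodule ℂ (L2 N) := (functionsOf (HarCube N))ᗮ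

theorem inner_toL2_one {N : ℕ} (f : L2 N) :
    inner ℂ (toL2 (fun _ => (1 : ℂ)) continuous_const) f = ∫ x in cube N, f x := by
  simpa using inner_toL2_conj f (continuous_const (y := (1 : ℂ)))

/-- `H¹_m(T^N)`, the functions in `H¹(T^N)` with mean zero. -/
def H1m (N : ℕ) : Submodule ℂ (Pairs N) where
  carrier := {u | u ∈ H1torus N ∧ ∫ x in cube N, u.fst x = 0}
  zero_mem' := ⟨Submodule.zero_mem _, by rw [← inner_toL2_one]; simp⟩
  add_mem' := by
    rintro a b ⟨ha, ha0⟩ ⟨hb, hb0⟩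
    refine ⟨Submodule.add_mem _ ha hb, ?_⟩
    rw [← inner_toL2_one] at ha0 hb0 ⊢
    simp only [WithLp.add_fst, inner_add_right, ha0, hb0, add_zero]
  smul_mem' := by
    rintro c a ⟨ha, ha0⟩
    refine ⟨Submodule.smul_mem _ c ha, ?_⟩
    rw [← inner_toL2_one] at ha0 ⊢
    simp only [WithLp.smul_fst, inner_smul_right, ha0, mul_zero]

theorem H1m_le_H1torus (N : ℕ) : H1m N ≤ H1torus N := fun _ h => h.1

/-! ### Dual spaces

The duality bracket extends the `L²` scalar product, hence is conjugate-linear in the second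
argument: the elements of the dual spaces are the bounded conjugate-linear functionals. -/

/-- `H⁻¹(T^N)`, the (anti)dual of `H¹(T^N)`. -/
abbrev Hm1torus (N : ℕ) : Type := H1torus N →L⋆[ℂ] ℂ

/-- `H⁻¹((0,1)^N)`, the (anti)dual of `H¹₀((0,1)^N)`. -/
abbrev Hm1cube (N : ℕ) : Type := H10 N →L⋆[ℂ] ℂ

/-- The embedding of `L²` into `H⁻¹(T^N)`: `⟨h, v⟩ = ∫ h conj(v) dx`. -/
def embedL2 {N : ℕ} (h : L2 N) : Hm1torus N :=
  (innerSLFlip ℂ h).comp ((functionOf N).comp (H1torus N).subtypeL)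

theorem embedL2_apply {N : ℕ} (h : L2 N) (v : H1torus N) :
    embedL2 h v = ∫ x in cube N, h x * conj ((v : Pairs N).fst x) := by
  have : embedL2 h v = inner ℂ (v : Pairs N).fst h := rfl
  rw [this, L2.inner_def]
  rfl

/-- `H`, the annihilator of `Har(T^N)` in `H⁻¹(T^N)`. -/
def H (N : ℕ) : Submodule ℂ (Hm1torus N) where
  carrier := {w | ∀ v : H1torus N, (v : Pairs N) ∈ HarTorus N → w v = 0}
  zero_mem' := fun _ _ => rfl
  add_mem' := fun ha hb v hv => by simp [ha v hv, hb v hv]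
  smul_mem' := fun c a ha v hv => by simp [ha v hv]

/-- `Id`, the projection of `H⁻¹(T^N) = H⁻¹((0,1)^N) ⊕ Har(T^N)'` onto `H⁻¹((0,1)^N)`. As this
decomposition is dual to `H¹(T^N) = H¹₀((0,1)^N) ⊕ Har(T^N)`, it restricts functionals to
`H¹₀((0,1)^N)`. -/
def Id (N : ℕ) : Hm1torus N →ₗ[ℂ] Hm1cube N where
  toFun w := w.comp ((H10 N).subtypeL.codRestrict (H1torus N) fun v => H10_le_H1torus N v.2)
  map_add' _ _ := rfl
  map_smul' _ _ := rfl

/-- `Id_m`, the restriction of `Id` to `H`. -/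
def Idm (N : ℕ) : H N →ₗ[ℂ] Hm1cube N := (Id N).comp (H N).subtype

/-- `u ∈ H¹_m(T^N)` solves `div ∇u = f - ⟨f, 1⟩`, i.e. `∫ ∇u · conj(∇v) = -⟨f, v⟩` for all
`v ∈ H¹_m(T^N)` (on which the constant `⟨f, 1⟩` vanishes). -/
def IsPotential {N : ℕ} (f : Hm1torus N) (u : H1torus N) : Prop :=
  (u : Pairs N) ∈ H1m N ∧
    ∀ (v : Pairs N) (hv : v ∈ H1m N), gradForm u v = - f ⟨v, H1m_le_H1torus N hv⟩

/-- `u_f`, the solution of the previous problem. -/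
def potential {N : ℕ} (f : Hm1torus N) : H1torus N := Classical.epsilon (IsPotential f)

/-- `ℓ ∈ H⁻¹((0,1)^N)` is the distributional Laplacian of `f ∈ L²((0,1)^N)`: on test functions,
`⟨ℓ, φ⟩ = ∫ f conj(Δφ) dx`. -/
def IsDistribLaplacian {N : ℕ} (f : L2 N) (ℓ : Hm1cube N) : Prop :=
  ∀ φ : 𝓓(cube N, ℂ), ℓ (testH10 φ) = ∫ x in cube N, f x * conj (classicalLaplacian φ x)

/-! ### The form and its operator -/

/-- The sesquilinear form `a(f, g) = ∫ f conj(g) dx`. -/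
def form {N : ℕ} (f g : L2 N) : ℂ := ∫ x in cube N, f x * conj (g x)

/-- `g` represents the functional `a(f, ·)` on `V` with respect to the inner product of `H`:
`a(f, h) = ∫ ∇u_g · conj(∇u_h) dx` for all `h ∈ V`. -/
def Represents {N : ℕ} (f : L2 N) (g : H N) : Prop :=
  ∀ h ∈ V N, form f h =
    gradForm (potential (g : Hm1torus N) : Pairs N) (potential (embedL2 h) : Pairs N)

/-- `D(A)`, the domain of the operator in `H` associated with the form `a` with domain `V`. -/
def domA (N : ℕ) : Set (L2 N) := {f | f ∈ V N ∧ ∃ g : H N, Represents f g}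

/-- The operator `A` itself: `A f` is the element of `H` that represents `a(f, ·)`. -/
def opA {N : ℕ} (f : domA N) : H N := f.2.2.choose

end CubeHeat

end

noncomputable section

namespace CubeHeat

/-! ### Fourier series on the cube -/

section Fourier

attribute [local instance] instMeasureSpaceUnitAddCircle

/-! Everything rests on one equivalence, `represents_iff`: `g` represents `a(f, ·)` exactly when `f
+ u_g ∈ V₁`. Testing the equation of `u_h` with `u_g` turns the inner product `∫ ∇u_g · conj(∇u_h)`
of `H` into `-(u_g|h)`. So the representation condition says `(f + u_g|h) = 0` for all `h ∈ V`, and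
`Vᗮ = V₁`.

The inclusion `D(A) ⊆ H¹_m + V₁` is then immediate. Conversely, let `f = u + w` with `u ∈ H¹_m` and
`w ∈ V₁`. The Dirichlet problem splits `u = z + k` with `z ∈ H¹₀` and `k ∈ Har(T^N)`. The functional
`g = ∫ ∇z · conj(∇·)` lies in `H`, and `u_g + z` is weakly harmonic, so `f + u_g = k + (u_g + z) +
w` lies in `V₁`. The same splitting makes `Id_m` bijective.

Elements of `V₁` are harmonic as distributions, since this passes to `L²` limits. Hence `Δf = -Δu_g
= -Id_m g`. It also gives uniqueness: the difference of two potentials lies in `V₁`, so it is weakly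
harmonic, and functionals in `H` vanish on it; its Dirichlet energy is therefore zero.

The analytic input is the Riesz theorem for the Dirichlet form (`existsUnique_gradForm_eq`), with
Poincaré inequalities on `H¹_m` (by Parseval) and on `H¹₀` (by integration by parts), together with
`H¹(T^N) ⊆ H¹((0,1)^N)`. -/

/-- The exponential `x ↦ exp(2πi k·x)`. -/
def expo {N : ℕ} (k : Fin N → ℤ) (x : Fin N → ℝ) : ℂ :=
  Complex.exp (2 * Real.pi * Complex.I * ∑ j, (k j : ℂ) * (x j : ℂ))

theorem mFourier_coe {N : ℕ} (k : Fin N → ℤ) (x : Fin N → ℝ) :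
    UnitAddTorus.mFourier k (fun i => (x i : UnitAddCircle)) = expo k x := by
  simp only [UnitAddTorus.mFourier, ContinuousMap.coe_mk, fourier_coe_apply, expo,
    ← Complex.exp_sum, Finset.mul_sum]
  congr 1
  refine Finset.sum_congr rfl fun j _ => ?_
  simp
  ring

theorem contDiff_expo {N : ℕ} (k : Fin N → ℤ) : ContDiff ℝ ∞ (expo k) := by
  refine ContDiff.cexp (contDiff_const.mul (ContDiff.sum fun j _ => contDiff_const.mul ?_))
  exact Complex.ofRealCLM.contDiff.comp (contDiff_apply ℝ ℝ j)

/-- Along a coordinate line the exponential is a one-variable exponential; `t = 1` gives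
periodicity, and differentiation at `t = 0` gives the gradient. -/
theorem expo_add_single {N : ℕ} (k : Fin N → ℤ) (x : Fin N → ℝ) (j : Fin N) (t : ℝ) :
    expo k (x + Pi.single j t) = expo k x * Complex.exp (2 * Real.pi * Complex.I * k j * t) := by
  rw [expo, expo, ← Complex.exp_add, mul_assoc _ (k j : ℂ), ← mul_add]
  congr 2
  simp only [Pi.add_apply, Complex.ofReal_add, mul_add, Finset.sum_add_distrib]
  congr 1
  rw [Finset.sum_eq_single j]
  · simp
  · intro i _ hi
    simp [hi]
  · simp

theorem expo_mem_torusTests {N : ℕ} (k : Fin N → ℤ) : expo k ∈ torusTests N := by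
  refine ⟨contDiff_expo k, fun x j => ?_⟩
  rw [expo_add_single, mul_comm (2 * (Real.pi : ℂ) * Complex.I)]
  simp [Complex.exp_int_mul_two_pi_mul_I (k j)]

theorem pd_expo {N : ℕ} (k : Fin N → ℤ) (j : Fin N) (x : Fin N → ℝ) :
    pd j (expo k) x = 2 * Real.pi * Complex.I * k j * expo k x := by
  have hd : DifferentiableAt ℝ (expo k) x := (contDiff_expo k).differentiable (by simp) x
  have h2 : HasDerivAt (fun t : ℝ => expo k (x + t • Pi.single j 1))
      (pd j (expo k) x) 0 := by
    have := hd.hasFDerivAt.hasLineDerivAt (Pi.single j 1)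
    exact this
  have h3 : HasDerivAt (fun t : ℝ => expo k (x + t • Pi.single j 1))
      (2 * Real.pi * Complex.I * k j * expo k x) 0 := by
    have he : (fun t : ℝ => expo k (x + t • Pi.single j 1)) =
        fun t : ℝ => expo k x * Complex.exp (2 * Real.pi * Complex.I * k j * t) := by
      funext t
      rw [← expo_add_single, ← Pi.single_smul]
      simp
    rw [he]
    have h4 : HasDerivAt (fun t : ℝ => 2 * Real.pi * Complex.I * (k j : ℂ) * (t : ℂ))
        (2 * Real.pi * Complex.I * k j * 1) 0 :=
      (Complex.ofRealCLM.hasDerivAt (x := (0 : ℝ))).const_mul _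
    have h5 := (h4.cexp.const_mul (expo k x))
    refine h5.congr_deriv ?_
    rw [Complex.ofReal_zero, mul_zero, Complex.exp_zero]
    ring
  exact h2.unique h3

/-- The faces are null sets; the half-open box is the fundamental domain on which torus integrals
are computed. -/
theorem cubeMeasure_eq_restrict_Ioc (N : ℕ) :
    cubeMeasure N = (volume : Measure (Fin N → ℝ)).restrict
      {x | ∀ i, x i ∈ Ioc ((0 : Fin N → ℝ) i) ((0 : Fin N → ℝ) i + 1)} := by
  have h : {x : Fin N → ℝ | ∀ i, x i ∈ Ioc ((0 : Fin N → ℝ) i) ((0 : Fin N → ℝ) i + 1)} =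
      Set.univ.pi fun _ => Ioc (0 : ℝ) 1 := by
    ext x
    simp [Set.mem_pi]
  rw [h]
  exact Measure.restrict_congr_set (Measure.univ_pi_Ioo_ae_eq_Icc.trans
    Measure.univ_pi_Ioc_ae_eq_Icc.symm)

/-- Parseval's identity on the cube. -/
theorem hasSum_sq_fourier {N : ℕ} (f : L2 N) :
    HasSum (fun k : Fin N → ℤ => ‖∫ x in cube N, f x * expo (-k) x‖ ^ 2) (‖f‖ ^ 2) := by
  -- `s` picks the representative in `(0,1]^N`, so `F = f ∘ s` is `f` transported to the torus,
  -- where Parseval is available.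
  let s : UnitAddTorus (Fin N) → Fin N → ℝ :=
    fun t => (UnitAddTorus.measurableEquivPiIoc (0 : Fin N → ℝ) t).1
  have hs : Measurable s :=
    measurable_subtype_coe.comp (UnitAddTorus.measurableEquivPiIoc (0 : Fin N → ℝ)).measurable
  let F : UnitAddTorus (Fin N) → ℂ := fun t => f (s t)
  have hFc : ∀ x : Fin N → ℝ, (∀ i, x i ∈ Ioc ((0 : Fin N → ℝ) i) ((0 : Fin N → ℝ) i + 1)) →
      F (fun i => (x i : UnitAddCircle)) = f x := by
    intro x hx
    have : s (fun i => (x i : UnitAddCircle)) = x := by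
      funext i
      exact congrArg Subtype.val (AddCircle.equivIoc_coe_eq (hx i))
    simp only [F, this]
  have hm : MeasurableSet
      {x : Fin N → ℝ | ∀ i, x i ∈ Ioc ((0 : Fin N → ℝ) i) ((0 : Fin N → ℝ) i + 1)} :=
    MeasurableSet.univ_pi' fun _ => measurableSet_Ioc
  have hFm : StronglyMeasurable F := (Lp.stronglyMeasurable f).comp_measurable hs
  have hL : MemLp F 2 volume := by
    refine ⟨hFm.aestronglyMeasurable, ?_⟩
    rw [eLpNorm_lt_top_iff_lintegral_rpow_enorm_lt_top (by simp) (by simp),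
      UnitAddTorus.lintegral_preimage _ 0, setLIntegral_congr_fun hm
        (g := fun x => ‖f x‖ₑ ^ (2 : ENNReal).toReal) (fun x hx => by simp only [hFc x hx]),
      ← cubeMeasure_eq_restrict_Ioc,
      ← eLpNorm_lt_top_iff_lintegral_rpow_enorm_lt_top (by simp) (by simp)]
    exact (Lp.memLp f).2
  have hP := UnitAddTorus.hasSum_sq_mFourierCoeff (hL.toLp F)
  have hn : ∫ t, ‖hL.toLp F t‖ ^ 2 = ‖f‖ ^ 2 := by
    have h1 : ∫ t, ‖hL.toLp F t‖ ^ 2 = ∫ t, ‖F t‖ ^ 2 := by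
      refine integral_congr_ae ?_
      filter_upwards [hL.coeFn_toLp] with t ht
      rw [ht]
    rw [h1, UnitAddTorus.integral_preimage _ 0, setIntegral_congr_fun hm
        (g := fun x => ‖f x‖ ^ 2) (fun x hx => by simp only [hFc x hx]),
      ← cubeMeasure_eq_restrict_Ioc, ← inner_self_eq_norm_sq (𝕜 := ℂ), L2.inner_def,
      ← integral_re (L2.integrable_inner f f)]
    simp only [inner_self_eq_norm_sq]
  rw [hn] at hP
  convert hP using 3 with k
  have h2 : UnitAddTorus.mFourierCoeff (hL.toLp F) k = UnitAddTorus.mFourierCoeff F k := by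
    refine integral_congr_ae ?_
    filter_upwards [hL.coeFn_toLp] with t ht
    rw [ht]
  rw [h2, UnitAddTorus.mFourierCoeff_eq_integral _ _ 0, setIntegral_congr_fun hm
        (g := fun x => f x * expo (-k) x)
        (fun x hx => by simp only [hFc x hx, mFourier_coe, smul_eq_mul, mul_comm]),
    ← cubeMeasure_eq_restrict_Ioc]

end Fourier

/-- Poincaré's inequality for functions on the torus with mean zero. -/
theorem poincare_H1m {N : ℕ} {u : Pairs N} (hu : u ∈ H1m N) : ‖u.fst‖ ≤ ‖u.snd‖ := by
  have hS : HasSum (fun k : Fin N → ℤ => ∑ j, ‖∫ x in cube N, u.snd j x * expo (-k) x‖ ^ 2)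
      (‖u.snd‖ ^ 2) := by
    rw [PiLp.norm_sq_eq_of_L2]
    exact hasSum_sum fun j _ => hasSum_sq_fourier (u.snd j)
  have h := hasSum_le (fun k => ?_) (hasSum_sq_fourier u.fst) hS
  · exact (pow_le_pow_iff_left₀ (norm_nonneg _) (norm_nonneg _) two_ne_zero).1 h
  -- The zeroth coefficient is the mean of `u`, which vanishes.
  by_cases hk : k = 0
  · subst hk
    have : ∫ x in cube N, u.fst x * expo (-0) x = 0 := by simpa [expo] using hu.2
    rw [this]
    simp only [norm_zero, ne_eq, OfNat.ofNat_ne_zero, not_false_eq_true, zero_pow]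
    positivity
  · obtain ⟨j, hj⟩ : ∃ j, k j ≠ 0 := by
      by_contra! hc
      exact hk (funext hc)
    -- One component suffices: the coefficient of `∂_j u` is `2πi k_j` times that of `u`, and
    -- `2π|k_j| ≥ 1`.
    refine le_trans ?_ (Finset.single_le_sum (fun j _ => by positivity) (Finset.mem_univ j))
    have hw := hu.1 _ (expo_mem_torusTests (-k)) j
    have hI : ∫ x in cube N, u.fst x * pd j (expo (-k)) x =
        (-(2 * Real.pi * Complex.I * k j)) * ∫ x in cube N, u.fst x * expo (-k) x := by
      rw [← integral_const_mul]
      refine integral_congr_ae (Filter.Eventually.of_forall fun x => ?_)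
      simp only [pd_expo, Pi.neg_apply, Int.cast_neg]
      ring
    rw [hI] at hw
    have hw2 : ∫ x in cube N, u.snd j x * expo (-k) x =
        (2 * Real.pi * Complex.I * k j) * ∫ x in cube N, u.fst x * expo (-k) x := by
      linear_combination hw
    rw [hw2, norm_mul]
    refine pow_le_pow_left₀ (norm_nonneg _) (le_mul_of_one_le_left (norm_nonneg _) ?_) 2
    have h1 : (1 : ℝ) ≤ ‖(k j : ℂ)‖ := by
      rw [Complex.norm_intCast]
      exact_mod_cast Int.one_le_abs hj
    simp only [norm_mul, Complex.norm_I, Complex.norm_real, mul_one, Complex.norm_ofNat,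
      Real.norm_eq_abs, abs_of_pos Real.pi_pos]
    nlinarith [Real.pi_gt_three]

/-! ### Comparison of the spaces -/

/-- The periodic extension of a function supported in the cube. -/
def periodize {N : ℕ} (φ : (Fin N → ℝ) → ℂ) (x : Fin N → ℝ) : ℂ :=
  ∑ᶠ m : Fin N → ℤ, φ (x + fun i => (m i : ℝ))

/-- Near any point only finitely many integer translates of the support contribute, so the sum is
locally finite. -/
theorem contDiff_periodize {N : ℕ} {φ : (Fin N → ℝ) → ℂ} (hφ : ContDiff ℝ ∞ φ)
    (hs : Function.support φ ⊆ cube N) : ContDiff ℝ ∞ (periodize φ) := by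
  have hl : LocallyFinite fun m : Fin N → ℤ =>
      Function.support fun x : Fin N → ℝ => φ (x + fun i => (m i : ℝ)) := ?_
  · exact (contMDiff_finsum
      (fun m => (hφ.comp (contDiff_id.add contDiff_const)).contMDiff) hl).contDiff
  intro x
  refine ⟨Metric.ball x 1, Metric.ball_mem_nhds x one_pos, ?_⟩
  -- From `|y_i - x_i| < 1` and `0 < y_i + m_i < 1` one gets `-x_i - 1 < m_i < 2 - x_i`.
  refine (Set.finite_Icc (fun i => ⌊-x i - 1⌋) (fun i => ⌈2 - x i⌉)).subset ?_
  rintro m ⟨y, hy, hyx⟩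
  have hc := hs (show y + (fun i => (m i : ℝ)) ∈ Function.support φ from hy)
  have hb : ∀ i, |y i - x i| < 1 := fun i =>
    (dist_le_pi_dist y x i).trans_lt hyx
  have hi : ∀ i, 0 < y i + m i ∧ y i + m i < 1 := fun i => hc i (mem_univ i)
  refine ⟨fun i => ?_, fun i => ?_⟩
  · have h1 := abs_lt.1 (hb i)
    have : (⌊-x i - 1⌋ : ℝ) ≤ m i := (Int.floor_le _).trans (by linarith [hi i])
    exact_mod_cast this
  · have h1 := abs_lt.1 (hb i)
    have : (m i : ℝ) ≤ ⌈2 - x i⌉ := le_trans (by linarith [hi i]) (Int.le_ceil _)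
    exact_mod_cast this

theorem periodize_add_single {N : ℕ} (φ : (Fin N → ℝ) → ℂ) (x : Fin N → ℝ) (j : Fin N) :
    periodize φ (x + Pi.single j 1) = periodize φ x := by
  unfold periodize
  rw [← finsum_comp_equiv (Equiv.addLeft (Pi.single j (1 : ℤ) : Fin N → ℤ))
    (f := fun m : Fin N → ℤ => φ (x + fun i => (m i : ℝ)))]
  refine finsum_congr fun m => congrArg φ ?_
  funext i
  by_cases h : i = j
  · subst h
    simp [add_assoc]
  · simp [h]

/-- Two points of the open cube that differ by an integer vector coincide, so only `m = 0`
contributes. -/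
theorem periodize_eq {N : ℕ} {φ : (Fin N → ℝ) → ℂ} (hs : Function.support φ ⊆ cube N)
    {x : Fin N → ℝ} (hx : x ∈ cube N) : periodize φ x = φ x := by
  unfold periodize
  rw [finsum_eq_single _ 0]
  · congr 1
    funext i
    simp
  · intro m hm
    by_contra hne
    have hc := hs (show x + (fun i => (m i : ℝ)) ∈ Function.support φ from hne)
    refine hm (funext fun i => ?_)
    have h1 : 0 < x i ∧ x i < 1 := hx i (mem_univ i)
    have h2 : 0 < x i + m i ∧ x i + m i < 1 := hc i (mem_univ i)
    have h3 : (-1 : ℝ) < m i := by linarith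
    have h4 : (m i : ℝ) < 1 := by linarith
    have h5 : -1 < m i := by exact_mod_cast h3
    have h6 : m i < 1 := by exact_mod_cast h4
    simp only [Pi.zero_apply]
    omega

/-- The periodic extension of a test function on the cube is admissible on the torus and agrees with
it on the open cube, hence so do the derivatives. -/
theorem H1torus_le_H1cube (N : ℕ) : H1torus N ≤ H1cube N := by
  rintro e he _ ⟨φ, rfl⟩ j
  have hs : Function.support (φ : (Fin N → ℝ) → ℂ) ⊆ cube N :=
    (subset_tsupport _).trans φ.tsupport_subset
  have h := he (periodize φ)
    ⟨contDiff_periodize φ.contDiff hs, fun x j => periodize_add_single _ x j⟩ j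
  have hpd : ∀ x ∈ (cube N : Set (Fin N → ℝ)), pd j (periodize φ) x = pd j φ x := by
    intro x hx
    have : periodize φ =ᶠ[nhds x] φ := by
      filter_upwards [(cube N).isOpen.mem_nhds hx] with y hy using periodize_eq hs hy
    simp only [pd, this.fderiv_eq]
  have h1 : ∫ x in cube N, e.fst x * pd j (periodize φ) x = ∫ x in cube N, e.fst x * pd j φ x :=
    setIntegral_congr_fun (cube N).isOpen.measurableSet fun x hx => by simp only [hpd x hx]
  have h2 : ∫ x in cube N, e.snd j x * periodize φ x = ∫ x in cube N, e.snd j x * φ x :=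
    setIntegral_congr_fun (cube N).isOpen.measurableSet fun x hx => by
      simp only [periodize_eq hs hx]
  rwa [h1, h2] at h

theorem HarTorus_le_HarCube (N : ℕ) : HarTorus N ≤ HarCube N :=
  fun _ h => ⟨H1torus_le_H1cube N h.1, h.2⟩

/-! ### Poincaré's inequality on `H¹₀` -/

theorem inner_toL2_toL2 {N : ℕ} {φ ψ : (Fin N → ℝ) → ℂ} (hφ : Continuous φ) (hψ : Continuous ψ) :
    inner ℂ (toL2 φ hφ : L2 N) (toL2 ψ hψ) = ∫ x in cube N, ψ x * conj (φ x) := by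
  have h := inner_toL2_conj (toL2 ψ hψ : L2 N) (Complex.continuous_conj.comp hφ)
  rw [← integral_toL2_mul hψ (fun x => conj (φ x))]
  simpa [Function.comp_def] using h

theorem pd_conj {N : ℕ} (j : Fin N) {φ : (Fin N → ℝ) → ℂ} (h : ContDiff ℝ ∞ φ) (x : Fin N → ℝ) :
    pd j (fun y => conj (φ y)) x = conj (pd j φ x) := by
  have hd : HasFDerivAt φ (fderiv ℝ φ x) x := (h.differentiable (by simp) x).hasFDerivAt
  have h2 := Complex.conjCLE.hasFDerivAt.comp x hd
  exact congrArg (· (Pi.single j 1)) h2.fderiv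

theorem contDiff_conj {N : ℕ} {φ : (Fin N → ℝ) → ℂ} (h : ContDiff ℝ ∞ φ) :
    ContDiff ℝ ∞ fun y => conj (φ y) :=
  Complex.conjCLE.contDiff.comp h

/-- Poincaré's inequality for test functions. -/
theorem poincare_test {N : ℕ} (j : Fin N) (φ : 𝓓(cube N, ℂ)) :
    ‖(gradPair φ φ.contDiff : Pairs N).fst‖ ≤ 2 * ‖(gradPair φ φ.contDiff : Pairs N).snd‖ := by
  have hφ : ContDiff ℝ ∞ (φ : (Fin N → ℝ) → ℂ) := φ.contDiff
  have hx : ContDiff ℝ ∞ fun x : Fin N → ℝ => ((x j : ℝ) : ℂ) :=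
    Complex.ofRealCLM.contDiff.comp (contDiff_apply ℝ ℝ j)
  have hψ : ContDiff ℝ ∞ fun x : Fin N → ℝ => ((x j : ℝ) : ℂ) * conj (φ x) :=
    hx.mul (contDiff_conj hφ)
  have hxφ : ContDiff ℝ ∞ fun x : Fin N → ℝ => ((x j : ℝ) : ℂ) * φ x := hx.mul hφ
  have hpd : ∀ x, pd j (fun x : Fin N → ℝ => ((x j : ℝ) : ℂ) * conj (φ x)) x =
      conj (φ x) + (x j : ℂ) * conj (pd j φ x) := by
    intro x
    have h1 : HasFDerivAt (fun x : Fin N → ℝ => ((x j : ℝ) : ℂ))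
        (Complex.ofRealCLM.comp (ContinuousLinearMap.proj j)) x :=
      (Complex.ofRealCLM.comp (ContinuousLinearMap.proj (R := ℝ) (φ := fun _ : Fin N => ℝ)
        j)).hasFDerivAt
    have h2 := ((contDiff_conj hφ).differentiable (by simp) x).hasFDerivAt
    have h3 := congrArg (· (Pi.single j 1)) (h1.mul h2).fderiv
    rw [← pd_conj j hφ]
    refine h3.trans ?_
    simp [pd]
    ring
  let a : L2 N := toL2 φ hφ.continuous
  let b : L2 N := toL2 (pd j φ) (contDiff_pd hφ j).continuous
  let c : L2 N := toL2 (fun x : Fin N → ℝ => ((x j : ℝ) : ℂ) * φ x) hxφ.continuous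
  -- Integration by parts of `φ` against `x_j conj(φ)`: differentiating the factor `x_j` produces `∫
  -- |φ|²`.
  have key : inner ℂ a a + inner ℂ b c = - inner ℂ c b := by
    have h := gradPair_mem φ {fun x : Fin N → ℝ => ((x j : ℝ) : ℂ) * conj (φ x)}
      (by rintro _ rfl; exact hψ) _ rfl j
    change ∫ x in cube N, a x * _ = - ∫ x in cube N, b x * _ at h
    rw [integral_toL2_mul, integral_toL2_mul] at h
    rw [inner_toL2_toL2, inner_toL2_toL2, inner_toL2_toL2, ← integral_add]
    · convert h using 1
      · refine integral_congr_ae (Filter.Eventually.of_forall fun x => ?_)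
        simp only [hpd]
        ring
      · congr 1
        refine integral_congr_ae (Filter.Eventually.of_forall fun x => ?_)
        simp
    · exact (memLp_cube (hφ.mul (contDiff_conj hφ)).continuous).integrable (by norm_num)
    · exact (memLp_cube (hxφ.mul (contDiff_conj (contDiff_pd hφ j))).continuous).integrable
        (by norm_num)
  -- Here `0 < x_j < 1` on the cube enters; the two cross terms then give the constant `2`.
  have hca : ‖c‖ ≤ ‖a‖ := by
    refine Lp.norm_le_norm_of_ae_le ?_
    filter_upwards [(memLp_cube (N := N) hφ.continuous).coeFn_toLp,
      (memLp_cube (N := N) hxφ.continuous).coeFn_toLp,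
      ae_restrict_mem (cube N).isOpen.measurableSet] with x h1 h2 h3
    have h3' : 0 < x j ∧ x j < 1 := h3 j (mem_univ j)
    have h1' : a x = φ x := h1
    have h2' : c x = (x j : ℂ) * φ x := h2
    rw [h1', h2', norm_mul, Complex.norm_real, Real.norm_eq_abs, abs_of_pos h3'.1]
    exact mul_le_of_le_one_left (norm_nonneg _) h3'.2.le
  have hab : ‖a‖ ≤ 2 * ‖b‖ := by
    have h1 : inner ℂ a a = - inner ℂ c b - inner ℂ b c := by linear_combination key
    have h2 : ‖a‖ ^ 2 ≤ 2 * (‖a‖ * ‖b‖) := by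
      calc ‖a‖ ^ 2 = ‖(inner ℂ a a : ℂ)‖ := by rw [inner_self_eq_norm_sq_to_K]; simp
        _ ≤ ‖(inner ℂ c b : ℂ)‖ + ‖(inner ℂ b c : ℂ)‖ := by
          rw [h1]
          exact (norm_sub_le _ _).trans (by rw [norm_neg])
        _ ≤ ‖c‖ * ‖b‖ + ‖b‖ * ‖c‖ := add_le_add (norm_inner_le_norm _ _) (norm_inner_le_norm _ _)
        _ ≤ 2 * (‖a‖ * ‖b‖) := by nlinarith [norm_nonneg b]
    rcases (norm_nonneg a).eq_or_lt with h0 | h0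
    · rw [← h0]
      positivity
    · nlinarith
  exact hab.trans (mul_le_mul_of_nonneg_left
    (PiLp.norm_apply_le (gradPair φ φ.contDiff : Pairs N).snd j) zero_le_two)

theorem gradPair_add {N : ℕ} {φ ψ : (Fin N → ℝ) → ℂ} (hφ : ContDiff ℝ ∞ φ) (hψ : ContDiff ℝ ∞ ψ) :
    gradPair (φ + ψ) (hφ.add hψ) = gradPair φ hφ + gradPair ψ hψ := by
  refine (WithLp.equiv 2 _).injective (Prod.ext rfl (PiLp.ext fun j => ?_))
  have h : pd j (φ + ψ) = pd j φ + pd j ψ := by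
    funext x
    simp only [pd, Pi.add_apply]
    rw [fderiv_add (hφ.differentiable (by simp) x) (hψ.differentiable (by simp) x)]
    rfl
  change toL2 (pd j (φ + ψ)) (contDiff_pd (hφ.add hψ) j).continuous = toL2 (pd j φ + pd j ψ)
    ((contDiff_pd hφ j).continuous.add (contDiff_pd hψ j).continuous)
  congr 1

theorem gradPair_smul {N : ℕ} (c : ℂ) {φ : (Fin N → ℝ) → ℂ} (hφ : ContDiff ℝ ∞ φ) :
    gradPair (c • φ) (hφ.const_smul c) = c • gradPair φ hφ := by
  refine (WithLp.equiv 2 _).injective (Prod.ext rfl (PiLp.ext fun j => ?_))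
  have h : pd j (c • φ) = c • pd j φ := by
    funext x
    simp only [pd, Pi.smul_apply]
    rw [fderiv_const_smul (hφ.differentiable (by simp) x)]
    rfl
  change toL2 (pd j (c • φ)) (contDiff_pd (hφ.const_smul c) j).continuous =
    toL2 (c • pd j φ) ((contDiff_pd hφ j).continuous.const_smul c)
  congr 1

/-- Test functions already form a subspace, so `H¹₀` is the closure of their pairs alone. Conditions
that are not linear, such as norm inequalities, can thus be checked by density. -/
theorem span_gradPair_cubeTests (N : ℕ) :
    (Submodule.span ℂ (range fun φ : 𝓓(cube N, ℂ) => gradPair φ φ.contDiff) : Set (Pairs N)) =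
      range fun φ : 𝓓(cube N, ℂ) => gradPair φ φ.contDiff := by
  refine Subset.antisymm (fun u hu => ?_) Submodule.subset_span
  induction hu using Submodule.span_induction with
  | mem x h => exact h
  | zero => exact ⟨0, by simpa using gradPair_smul 0 (0 : 𝓓(cube N, ℂ)).contDiff⟩
  | add x y _ _ hx hy =>
    obtain ⟨φ, rfl⟩ := hx
    obtain ⟨ψ, rfl⟩ := hy
    exact ⟨φ + ψ, gradPair_add φ.contDiff ψ.contDiff⟩
  | smul c x _ hx =>
    obtain ⟨φ, rfl⟩ := hx
    exact ⟨c • φ, gradPair_smul c φ.contDiff⟩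

/-- To check a closed condition on `H¹₀` it suffices to check it on test functions. -/
theorem H10_induction {N : ℕ} {P : Pairs N → Prop} (hP : IsClosed {u | P u})
    (h : ∀ φ : 𝓓(cube N, ℂ), P (gradPair φ φ.contDiff)) {u : Pairs N} (hu : u ∈ H10 N) : P u := by
  have hu' : u ∈ closure
      (Submodule.span ℂ (range fun φ : 𝓓(cube N, ℂ) => gradPair φ φ.contDiff) : Set (Pairs N)) := hu
  rw [span_gradPair_cubeTests] at hu'
  exact closure_minimal (by rintro _ ⟨φ, rfl⟩; exact h φ) hP hu'

/-- Poincaré's inequality in `H¹₀`. -/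
theorem poincare_H10 {N : ℕ} (hN : 1 ≤ N) {u : Pairs N} (hu : u ∈ H10 N) :
    ‖u.fst‖ ≤ 2 * ‖u.snd‖ := by
  refine H10_induction (P := fun u => ‖u.fst‖ ≤ 2 * ‖u.snd‖) ?_ (poincare_test ⟨0, hN⟩) hu
  exact isClosed_le (WithLp.fstL 2 ℂ _ _ : Pairs N →L[ℂ] _).continuous.norm
    (continuous_const.mul (WithLp.sndL 2 ℂ _ _ : Pairs N →L[ℂ] _).continuous.norm)

/-! ### Constants -/

/-- The integral over the cube of a partial derivative of a periodic function vanishes. -/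
theorem integral_pd_torusTests {N : ℕ} {ψ : (Fin N → ℝ) → ℂ} (hψ : ψ ∈ torusTests N) (j : Fin N) :
    ∫ x in cube N, pd j ψ x = 0 := by
  -- The divergence theorem is stated in dimension `n + 1`; the index `j` excludes dimension `0`.
  obtain ⟨n, rfl⟩ : ∃ n, N = n + 1 := ⟨N - 1, by have := j.2; omega⟩
  have hc : ContDiff ℝ ∞ ψ := hψ.1
  have hsum : ∀ x : Fin (n + 1) → ℝ, (∑ i, (if i = j then fderiv ℝ ψ x else 0) (Pi.single i 1)) =
      pd j ψ x := by
    intro x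
    rw [Finset.sum_eq_single j]
    · simp [pd]
    · intro i _ hi
      simp [hi]
    · simp
  have hae : (cube (n + 1) : Set (Fin (n + 1) → ℝ)) =ᵐ[volume] Icc 0 1 :=
    Measure.univ_pi_Ioo_ae_eq_Icc (f := fun _ => (0 : ℝ)) (g := fun _ => (1 : ℝ))
  -- The vector field has `ψ` as its `j`-th component and zeros elsewhere.
  have h := integral_divergence_of_hasFDerivAt_off_countable' (E := ℂ) (0 : Fin (n + 1) → ℝ) 1
    zero_le_one (fun i => if i = j then ψ else 0)
    (fun i x => if i = j then fderiv ℝ ψ x else 0) ∅ countable_empty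
    (fun i => by
      by_cases hi : i = j
      · simpa [hi] using hc.continuous.continuousOn
      · simp only [if_neg hi]
        exact continuousOn_const)
    (fun x _ i => by
      by_cases hi : i = j
      · simpa [hi] using (hc.differentiable (by simp) x).hasFDerivAt
      · simp only [if_neg hi]
        exact hasFDerivAt_const (0 : ℂ) x)
    (by
      simp only [hsum]
      exact (contDiff_pd hc j).continuous.continuousOn.integrableOn_compact isCompact_Icc)
  simp only [hsum] at h
  rw [setIntegral_congr_set hae, h]
  refine Finset.sum_eq_zero fun i _ => sub_eq_zero.2 ?_
  by_cases hi : i = j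
  · subst hi
    refine integral_congr_ae (Filter.Eventually.of_forall fun x => ?_)
    -- Opposite faces differ by a unit vector, so their contributions cancel by periodicity.
    have hx : i.insertNth (α := fun _ => ℝ) 1 x = i.insertNth (α := fun _ => ℝ) 0 x +
        Pi.single i 1 := by
      refine (Fin.insertNth_eq_iff).2 ⟨by simp, ?_⟩
      funext k
      simp [Fin.removeNth]
    simp only [if_true, Pi.one_apply, Pi.zero_apply]
    rw [hx, hψ.2]
  · simp [hi]

/-- The constant function `1`. -/
def onePair (N : ℕ) : Pairs N := WithLp.toLp 2 (toL2 (fun _ => (1 : ℂ)) continuous_const, 0)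

theorem onePair_mem_HarTorus (N : ℕ) : onePair N ∈ HarTorus N := by
  refine ⟨fun ψ hψ j => ?_, fun v _ => ?_⟩
  · change ∫ x in cube N, (toL2 (fun _ => (1 : ℂ)) continuous_const : L2 N) x * pd j ψ x =
      - ∫ x in cube N, (0 : L2 N) x * ψ x
    rw [integral_toL2_mul, ← inner_toL2_conj _ hψ.1.continuous, inner_zero_right]
    simpa using integral_pd_torusTests hψ j
  · rw [gradForm_eq_inner]
    exact inner_zero_right _

theorem integral_onePair (N : ℕ) : ∫ x in cube N, (onePair N).fst x = 1 := by
  have h := integral_toL2_mul (N := N) (continuous_const (y := (1 : ℂ))) fun _ => 1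
  simp only [mul_one] at h
  refine h.trans ?_
  have : volume.real (cube N : Set (Fin N → ℝ)) = 1 := by
    rw [measureReal_def]
    change (volume (Set.univ.pi fun _ : Fin N => Ioo (0 : ℝ) 1)).toReal = 1
    rw [Real.volume_pi_Ioo]
    simp
  simp [this]

theorem gradForm_onePair {N : ℕ} (u : Pairs N) : gradForm u (onePair N) = 0 := by
  rw [gradForm_eq_inner]
  exact inner_zero_left _

/-- Every function in `H¹(T^N)` is the sum of a function with mean zero and a constant. -/
theorem exists_sub_smul_onePair_mem_H1m {N : ℕ} {v : Pairs N} (hv : v ∈ H1torus N) :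
    ∃ c : ℂ, v - c • onePair N ∈ H1m N := by
  refine ⟨∫ x in cube N, v.fst x, Submodule.sub_mem _ hv
    (Submodule.smul_mem _ _ (onePair_mem_HarTorus N).1), ?_⟩
  rw [← inner_toL2_one, WithLp.sub_fst, WithLp.smul_fst, inner_sub_right, inner_smul_right,
    inner_toL2_one, inner_toL2_one, integral_onePair, mul_one, sub_self]

theorem isClosed_H1m (N : ℕ) : IsClosed (H1m N : Set (Pairs N)) := by
  have : (H1m N : Set (Pairs N)) = (H1torus N : Set (Pairs N)) ∩
      {u | inner ℂ (toL2 (fun _ => (1 : ℂ)) continuous_const) u.fst = 0} := by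
    ext u
    simp only [mem_inter_iff, mem_ofPred_eq, inner_toL2_one]
    rfl
  rw [this]
  exact (isClosed_weakGradientPairs _ _).inter
    (isClosed_eq (continuous_const.inner (WithLp.fstL 2 ℂ _ _).continuous) continuous_const)

/-! ### The Riesz representation theorem for the Dirichlet form -/

/-- `u ↦ ∫ ∇z · conj(∇u)` as a bounded conjugate-linear functional on a space of pairs. -/
def gradFunctional {N : ℕ} (K : Submodule ℂ (Pairs N)) (z : Pairs N) : K →L⋆[ℂ] ℂ :=
  (innerSLFlip ℂ z.snd).comp ((WithLp.sndL 2 ℂ _ _ : Pairs N →L[ℂ] _).comp K.subtypeL)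

theorem gradFunctional_apply {N : ℕ} (K : Submodule ℂ (Pairs N)) (z : Pairs N) (v : K) :
    gradFunctional K z v = gradForm z v := by
  rw [gradForm_eq_inner]
  rfl

/-- The Poincaré bound makes the gradient map bounded below on `K`, hence an isomorphism onto a
closed subspace of `(L²)^N`. The Riesz theorem is applied there and pulled back. -/
theorem existsUnique_gradForm_eq {N : ℕ} {K : Submodule ℂ (Pairs N)}
    (hK : IsClosed (K : Set (Pairs N))) {C : ℝ} (hC0 : 0 ≤ C)
    (hC : ∀ u ∈ K, ‖u.fst‖ ≤ C * ‖u.snd‖) (ℓ : K →L⋆[ℂ] ℂ) :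
    ∃! z : K, ∀ v : K, gradForm (z : Pairs N) v = ℓ v := by
  have : CompleteSpace K := hK.completeSpace_coe
  let T : K →L[ℂ] PiLp 2 fun _ : Fin N => L2 N :=
    (WithLp.sndL 2 ℂ _ _ : Pairs N →L[ℂ] _).comp K.subtypeL
  have hT : AntilipschitzWith (C + 1).toNNReal T := by
    refine T.antilipschitz_of_bound fun u => ?_
    rw [Real.coe_toNNReal _ (by positivity)]
    change ‖(u : Pairs N)‖ ≤ (C + 1) * ‖(u : Pairs N).snd‖
    have h1 := WithLp.prod_norm_sq_eq_of_L2 (u : Pairs N)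
    have h2 := hC u u.2
    refine le_of_sq_le_sq ?_ (by positivity)
    rw [h1]
    nlinarith [norm_nonneg (u : Pairs N).fst, norm_nonneg (u : Pairs N).snd,
      pow_le_pow_left₀ (norm_nonneg _) h2 2, mul_nonneg hC0 (sq_nonneg ‖(u : Pairs N).snd‖)]
  have hcl : IsClosed (range T) := hT.isClosed_range T.uniformContinuous
  let e := ContinuousLinearMap.equivRange hT.injective hcl
  have : CompleteSpace T.range := hcl.completeSpace_coe
  -- Riesz needs a linear functional, so the conjugate-linear `ℓ` is composed with conjugation.
  let L : StrongDual ℂ T.range := ((starL ℂ : ℂ ≃L⋆[ℂ] ℂ) : ℂ →L⋆[ℂ] ℂ).comp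
    (ℓ.comp (e.symm : T.range →L[ℂ] K))
  let y := (InnerProductSpace.toDual ℂ T.range).symm L
  have hy : ∀ v : K, gradForm (e.symm y : Pairs N) v = ℓ v := by
    intro v
    have h1 : inner ℂ y (e v) = conj (ℓ v) := by
      rw [InnerProductSpace.toDual_symm_apply]
      change conj (ℓ (e.symm (e v))) = _
      rw [e.symm_apply_apply]
    have h2 : (e.symm y : Pairs N).snd = (y : PiLp 2 fun _ : Fin N => L2 N) :=
      congrArg Subtype.val (e.apply_symm_apply y)
    rw [gradForm_eq_inner, h2, ← inner_conj_symm]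
    change conj (inner ℂ y (e v)) = _
    rw [h1, Complex.conj_conj]
  refine ⟨e.symm y, hy, fun z hz => hT.injective ?_⟩
  refine sub_eq_zero.1 (inner_self_eq_zero (𝕜 := ℂ).1 ?_)
  rw [← map_sub]
  have h1 := hz (z - e.symm y)
  rw [← hy (z - e.symm y), gradForm_eq_inner, gradForm_eq_inner, ← sub_eq_zero,
    ← inner_sub_right] at h1
  exact h1

/-! ### Potentials -/

theorem existsUnique_isPotential {N : ℕ} (f : Hm1torus N) : ∃! u : H1torus N, IsPotential f u := by
  let ι : H1m N →L[ℂ] H1torus N :=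
    (H1m N).subtypeL.codRestrict (H1torus N) fun v => H1m_le_H1torus N v.2
  obtain ⟨z, hz, huniq⟩ := existsUnique_gradForm_eq (isClosed_H1m N) zero_le_one
    (fun u hu => by simpa using poincare_H1m hu) (-(f.comp ι))
  refine ⟨⟨z, H1m_le_H1torus N z.2⟩, ⟨z.2, fun v hv => hz ⟨v, hv⟩⟩, fun u hu => ?_⟩
  have := huniq ⟨u, hu.1⟩ fun v => hu.2 v v.2
  exact Subtype.ext (congrArg (fun z : H1m N => (z : Pairs N)) this)

theorem isPotential_potential {N : ℕ} (f : Hm1torus N) : IsPotential f (potential f) :=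
  Classical.epsilon_spec (existsUnique_isPotential f).exists

theorem gradForm_conj_symm {N : ℕ} (u v : Pairs N) : conj (gradForm u v) = gradForm v u := by
  rw [gradForm_eq_inner, gradForm_eq_inner, inner_conj_symm]

theorem gradForm_add_left {N : ℕ} (u u' v : Pairs N) :
    gradForm (u + u') v = gradForm u v + gradForm u' v := by
  simp [gradForm_eq_inner]

theorem gradForm_sub_left {N : ℕ} (u u' v : Pairs N) :
    gradForm (u - u') v = gradForm u v - gradForm u' v := by
  simp [gradForm_eq_inner]

theorem gradForm_sub_right {N : ℕ} (u v v' : Pairs N) :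
    gradForm u (v - v') = gradForm u v - gradForm u v' := by
  simp [gradForm_eq_inner]

theorem gradForm_smul_right {N : ℕ} (c : ℂ) (u v : Pairs N) :
    gradForm u (c • v) = conj c * gradForm u v := by
  simp [gradForm_eq_inner, mul_comm]

/-- For `g ∈ H` the equation defining the potential holds on the whole of `H¹(T^N)`. -/
theorem gradForm_potential {N : ℕ} (g : H N) (v : H1torus N) :
    gradForm (potential (g : Hm1torus N) : Pairs N) v = - (g : Hm1torus N) v := by
  obtain ⟨c, hc⟩ := exists_sub_smul_onePair_mem_H1m v.2
  have h := (isPotential_potential (g : Hm1torus N)).2 _ hc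
  have hv : (⟨(v : Pairs N) - c • onePair N, H1m_le_H1torus N hc⟩ : H1torus N) =
      v - c • ⟨onePair N, (onePair_mem_HarTorus N).1⟩ := rfl
  -- Constants lie in `Har(T^N)`, so `g` annihilates them, and they have zero gradient.
  rw [hv, map_sub, map_smulₛₗ, g.2 ⟨onePair N, _⟩ (onePair_mem_HarTorus N), smul_zero, sub_zero,
    gradForm_sub_right, gradForm_smul_right, gradForm_onePair, mul_zero, sub_zero] at h
  exact h

/-- The equation of `u_h` may be tested with `u_g`, which has mean zero; a conjugation swaps the
arguments. -/
theorem gradForm_potential_embedL2 {N : ℕ} (g : Hm1torus N) (h : L2 N) :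
    gradForm (potential g : Pairs N) (potential (embedL2 h) : Pairs N) =
      - inner ℂ h (potential g : Pairs N).fst := by
  rw [← gradForm_conj_symm, (isPotential_potential (embedL2 h)).2 _ (isPotential_potential g).1]
  change conj (- inner ℂ (potential g : Pairs N).fst h) = _
  rw [map_neg, inner_conj_symm]

/-! ### Representing elements in terms of `V₁` -/

theorem form_eq_inner {N : ℕ} (f h : L2 N) : form f h = inner ℂ h f := by
  rw [L2.inner_def]
  rfl

theorem orthogonal_V (N : ℕ) : (V N)ᗮ = V1 N := Submodule.orthogonal_orthogonal_eq_closure _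

/-- The inner product of `H` equals `-(u_g|h)`, so the condition is orthogonality of `f + u_g` to
`V`. -/
theorem represents_iff {N : ℕ} (f : L2 N) (g : H N) :
    Represents f g ↔ f + (potential (g : Hm1torus N) : Pairs N).fst ∈ V1 N := by
  rw [← orthogonal_V, Submodule.mem_orthogonal]
  refine forall₂_congr fun h _ => ?_
  rw [form_eq_inner, gradForm_potential_embedL2, inner_add_right, ← sub_eq_zero, sub_neg_eq_add]

/-! ### Weak harmonicity -/

/-- The complex conjugate of a test function. -/
def conjTest {N : ℕ} (φ : 𝓓(cube N, ℂ)) : 𝓓(cube N, ℂ) where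
  toFun x := conj (φ x)
  contDiff' := contDiff_conj φ.contDiff
  hasCompactSupport' := φ.hasCompactSupport.comp_left (map_zero _)
  tsupport_subset' := by
    refine Subset.trans (closure_mono fun x hx => ?_) φ.tsupport_subset
    simpa using hx

/-- A partial derivative of a test function. -/
def pdTest {N : ℕ} (j : Fin N) (φ : 𝓓(cube N, ℂ)) : 𝓓(cube N, ℂ) where
  toFun := pd j φ
  contDiff' := contDiff_pd φ.contDiff j
  hasCompactSupport' := φ.hasCompactSupport.fderiv_apply ℝ _
  tsupport_subset' := (tsupport_fderiv_apply_subset ℝ _).trans φ.tsupport_subset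

theorem contDiff_classicalLaplacian {N : ℕ} {φ : (Fin N → ℝ) → ℂ} (h : ContDiff ℝ ∞ φ) :
    ContDiff ℝ ∞ (classicalLaplacian φ) :=
  ContDiff.sum fun j _ => contDiff_pd (contDiff_pd h j) j

theorem inner_toL2_left {N : ℕ} (f : L2 N) {φ : (Fin N → ℝ) → ℂ} (h : Continuous φ) :
    inner ℂ (toL2 φ h) f = ∫ x in cube N, f x * conj (φ x) := by
  simpa [Function.comp_def] using inner_toL2_conj f (Complex.continuous_conj.comp h)

/-- Green's formula against test functions. -/
theorem integral_mul_conj_classicalLaplacian {N : ℕ} {u : Pairs N} (hu : u ∈ H1cube N)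
    (φ : 𝓓(cube N, ℂ)) :
    ∫ x in cube N, u.fst x * conj (classicalLaplacian φ x) =
      - gradForm u (gradPair φ φ.contDiff) := by
  have h1 : ∀ j, ∫ x in cube N, u.fst x * conj (pd j (pd j φ) x) =
      - ∫ x in cube N, u.snd j x * conj (pd j φ x) := by
    intro j
    have h := hu _ ⟨conjTest (pdTest j φ), rfl⟩ j
    refine Eq.trans (integral_congr_ae (Filter.Eventually.of_forall fun x =>
      congrArg (u.fst x * ·) (pd_conj j (contDiff_pd φ.contDiff j) x).symm)) h
  have h2 : gradForm u (gradPair φ φ.contDiff) =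
      ∑ j, ∫ x in cube N, u.snd j x * conj (pd j φ x) := by
    rw [gradForm_eq_inner, PiLp.inner_apply]
    exact Finset.sum_congr rfl fun j _ => inner_toL2_left _ (contDiff_pd φ.contDiff j).continuous
  rw [h2, ← Finset.sum_neg_distrib, ← Finset.sum_congr rfl fun j _ => h1 j,
    ← integral_finsetSum]
  · simp only [classicalLaplacian, map_sum, Finset.mul_sum]
  · intro j _
    exact integrable_mul_cube _
      (contDiff_conj (contDiff_pd (contDiff_pd φ.contDiff j) j)).continuous

/-- The functions in `V₁` are harmonic in the sense of distributions. -/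
theorem integral_mul_conj_classicalLaplacian_of_mem_V1 {N : ℕ} {w : L2 N} (hw : w ∈ V1 N)
    (φ : 𝓓(cube N, ℂ)) : ∫ x in cube N, w x * conj (classicalLaplacian φ x) = 0 := by
  have hc := (contDiff_classicalLaplacian φ.contDiff).continuous
  rw [← inner_toL2_left w hc]
  refine closure_minimal (t := {w | inner ℂ (toL2 (classicalLaplacian φ) hc) w = 0}) ?_
    (isClosed_eq (continuous_const.inner continuous_id) continuous_const) hw
  rintro _ ⟨u, hu, rfl⟩
  change inner ℂ _ u.fst = 0
  have h0 : gradForm u (gradPair φ φ.contDiff) = 0 := hu.2 _ (testH10 φ).2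
  rw [inner_toL2_left, integral_mul_conj_classicalLaplacian hu.1, h0, neg_zero]

/-- Membership in `V₁` gives only distributional harmonicity; for a Sobolev function Green's formula
and density of test functions upgrade it to weak harmonicity. -/
theorem mem_HarTorus_of_fst_mem_V1 {N : ℕ} {u : Pairs N} (hu : u ∈ H1torus N)
    (h : u.fst ∈ V1 N) : u ∈ HarTorus N := by
  refine ⟨hu, fun v hv => H10_induction (P := fun v => gradForm u v = 0) ?_ (fun φ => ?_) hv⟩
  · simp only [gradForm_eq_inner]
    exact isClosed_eq ((WithLp.sndL 2 ℂ _ _ : Pairs N →L[ℂ] _).continuous.inner continuous_const)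
      continuous_const
  · have h1 := integral_mul_conj_classicalLaplacian (H1torus_le_H1cube N hu) φ
    rw [integral_mul_conj_classicalLaplacian_of_mem_V1 h] at h1
    exact neg_eq_zero.1 h1.symm

theorem fst_mem_V1 {N : ℕ} {u : Pairs N} (hu : u ∈ HarTorus N) : u.fst ∈ V1 N :=
  Submodule.le_topologicalClosure _ ⟨u, HarTorus_le_HarCube N hu, rfl⟩

theorem represents_unique {N : ℕ} {f : L2 N} {g g' : H N} (hg : Represents f g)
    (hg' : Represents f g') : g = g' := by
  rw [represents_iff] at hg hg'
  set d : H1torus N := potential (g : Hm1torus N) - potential (g' : Hm1torus N) with hd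
  have hdv : ∀ v : H1torus N, gradForm (d : Pairs N) v =
      (g' : Hm1torus N) v - (g : Hm1torus N) v := by
    intro v
    have : (d : Pairs N) = potential (g : Hm1torus N) - potential (g' : Hm1torus N) := rfl
    rw [this, gradForm_sub_left, gradForm_potential, gradForm_potential]
    ring
  have hH : (d : Pairs N) ∈ HarTorus N := by
    refine mem_HarTorus_of_fst_mem_V1 d.2 ?_
    have := Submodule.sub_mem _ hg hg'
    rwa [add_sub_add_left_eq_sub] at this
  -- Testing with `d` itself: being harmonic, `d` is annihilated by both `g` and `g'`.
  have h0 : gradForm (d : Pairs N) d = 0 := by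
    rw [hdv, g.2 d hH, g'.2 d hH, sub_zero]
  have hs : (d : Pairs N).snd = 0 := by
    rw [gradForm_eq_inner] at h0
    exact inner_self_eq_zero.1 h0
  refine Subtype.ext (ContinuousLinearMap.ext fun v => ?_)
  have h1 := hdv v
  rw [gradForm_eq_inner, hs, inner_zero_right] at h1
  exact (sub_eq_zero.1 h1.symm).symm

/-! ### The Dirichlet problem and the main theorem -/

theorem exists_gradForm_eq_of_H10 {N : ℕ} (hN : 1 ≤ N) (ℓ : Hm1cube N) :
    ∃ z ∈ H10 N, ∀ v : H10 N, gradForm z v = ℓ v := by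
  obtain ⟨z, hz, -⟩ := existsUnique_gradForm_eq (Submodule.isClosed_topologicalClosure _)
    zero_le_two (fun u hu => poincare_H10 hN hu) ℓ
  exact ⟨z, z.2, hz⟩

/-- `H¹(T^N) = H¹₀((0,1)^N) + Har(T^N)`. -/
theorem exists_sub_mem_HarTorus {N : ℕ} (hN : 1 ≤ N) {u : Pairs N} (hu : u ∈ H1torus N) :
    ∃ z ∈ H10 N, u - z ∈ HarTorus N := by
  obtain ⟨z, hz, h⟩ := exists_gradForm_eq_of_H10 hN (gradFunctional (H10 N) u)
  refine ⟨z, hz, Submodule.sub_mem _ hu (H10_le_H1torus N hz), fun v hv => ?_⟩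
  rw [gradForm_sub_left, h ⟨v, hv⟩, gradFunctional_apply, sub_self]

/-- For `z ∈ H¹₀` the functional `v ↦ ∫ ∇z · conj(∇v)` belongs to `H`. -/
def gradH {N : ℕ} (z : Pairs N) (hz : z ∈ H10 N) : H N :=
  ⟨gradFunctional (H1torus N) z, fun v hv => by
    rw [gradFunctional_apply, ← gradForm_conj_symm, hv.2 z hz, map_zero]⟩

/-- A functional in `H` is determined on `H¹₀` because `H¹₀ + Har(T^N)` is all of `H¹(T^N)`; a
preimage of `ℓ` comes from the Dirichlet problem through `gradH`. -/
theorem bijective_Idm {N : ℕ} (hN : 1 ≤ N) : Function.Bijective (Idm N) := by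
  refine ⟨(injective_iff_map_eq_zero _).2 fun w hw => ?_, fun ℓ => ?_⟩
  · refine Subtype.ext (ContinuousLinearMap.ext fun v => ?_)
    obtain ⟨z, hz, hh⟩ := exists_sub_mem_HarTorus hN v.2
    have hv : v = ⟨z, H10_le_H1torus N hz⟩ + ⟨v - z, hh.1⟩ :=
      Subtype.ext (add_sub_cancel z (v : Pairs N)).symm
    have h1 : (w : Hm1torus N) ⟨z, H10_le_H1torus N hz⟩ = 0 := by
      have h1' : Idm N w ⟨z, hz⟩ = 0 := by
        rw [hw]
        rfl
      exact h1'
    rw [hv, map_add, h1, w.2 _ hh, add_zero]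
    rfl
  · obtain ⟨z, hz, h⟩ := exists_gradForm_eq_of_H10 hN ℓ
    refine ⟨gradH z hz, ContinuousLinearMap.ext fun v => ?_⟩
    rw [← h v]
    exact gradFunctional_apply (H1torus N) z ⟨v, H10_le_H1torus N v.2⟩

theorem exists_represents {N : ℕ} (hN : 1 ≤ N) {f : L2 N}
    (hf : f ∈ functionsOf (H1m N) ⊔ V1 N) : ∃ g : H N, Represents f g := by
  obtain ⟨_, ⟨u, hu, rfl⟩, w, hw, rfl⟩ := Submodule.mem_sup.1 hf
  obtain ⟨z, hz, hk⟩ := exists_sub_mem_HarTorus hN hu.1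
  refine ⟨gradH z hz, (represents_iff _ _).2 ?_⟩
  set p := potential (gradH z hz : Hm1torus N)
  -- The potential satisfies `∫ ∇p · conj(∇v) = -∫ ∇z · conj(∇v)`, so the sum is harmonic.
  have hd : (p : Pairs N) + z ∈ HarTorus N := by
    refine ⟨Submodule.add_mem _ p.2 (H10_le_H1torus N hz), fun v hv => ?_⟩
    rw [gradForm_add_left]
    have h1 := gradForm_potential (gradH z hz) ⟨v, H10_le_H1torus N hv⟩
    have h2 := gradFunctional_apply (H1torus N) z ⟨v, H10_le_H1torus N hv⟩
    change gradForm (p : Pairs N) v = - gradFunctional (H1torus N) z ⟨v, _⟩ at h1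
    rw [h1, h2, neg_add_cancel]
  -- This is `f + p = (u - z) + (p + z) + w`, each summand lying in `V₁`.
  have := Submodule.add_mem _ (Submodule.add_mem _ (fst_mem_V1 hk) (fst_mem_V1 hd)) hw
  convert this using 1
  change u.fst + w + (p : Pairs N).fst = _
  rw [WithLp.sub_fst, WithLp.add_fst]
  abel

theorem domA_eq {N : ℕ} (hN : 1 ≤ N) :
    domA N = ((V N ⊓ (functionsOf (H1m N) ⊔ V1 N) : Submodule ℂ (L2 N)) : Set (L2 N)) := by
  ext f
  refine ⟨fun ⟨hV, g, hg⟩ => ⟨hV, ?_⟩, fun ⟨hV, hf⟩ => ⟨hV, exists_represents hN hf⟩⟩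
  have hp := (isPotential_potential (g : Hm1torus N)).1
  have hp' : (potential (g : Hm1torus N) : Pairs N).fst ∈ functionsOf (H1m N) := ⟨_, hp, rfl⟩
  have := Submodule.add_mem_sup (Submodule.neg_mem _ hp') ((represents_iff _ _).1 hg)
  rwa [add_comm f, neg_add_cancel_left] at this

/-- If `g` represents `a(f, ·)`, then `-Id_m g` is the distributional Laplacian of `f`. -/
theorem isDistribLaplacian_of_represents {N : ℕ} {f : L2 N} {g : H N} (hg : Represents f g) :
    IsDistribLaplacian f (-(Idm N g)) := by
  intro φ
  have hc := (contDiff_classicalLaplacian φ.contDiff).continuous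
  set p := potential (g : Hm1torus N)
  have h1 := integral_mul_conj_classicalLaplacian_of_mem_V1 ((represents_iff _ _).1 hg) φ
  have h2 := integral_mul_conj_classicalLaplacian (H1torus_le_H1cube N p.2) φ
  rw [← inner_toL2_left _ hc] at h1 h2 ⊢
  -- Since `f + p` is harmonic as a distribution, `Δf = -Δp`, and `Δp` is computed by Green's
  -- formula.
  rw [inner_add_right, h2] at h1
  have h3 := gradForm_potential g ⟨_, H10_le_H1torus N (testH10 φ).2⟩
  change gradForm (p : Pairs N) (gradPair φ φ.contDiff) = - Idm N g (testH10 φ) at h3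
  rw [h3] at h1
  rw [neg_apply]
  linear_combination -h1

end CubeHeat

end

theorem mainTheorem3 (N : ℕ) (hN : 1 ≤ N) :
    (∀ f : CubeHeat.Hm1torus N, ∃! u : CubeHeat.H1torus N, CubeHeat.IsPotential f u) ∧
    (∀ f ∈ CubeHeat.domA N, ∃! g : CubeHeat.H N, CubeHeat.Represents f g) ∧
    CubeHeat.domA N =
      ((CubeHeat.V N ⊓ (CubeHeat.functionsOf (CubeHeat.H1m N) ⊔ CubeHeat.V1 N) :
        Submodule ℂ (CubeHeat.L2 N)) : Set (CubeHeat.L2 N)) ∧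
    ∃ hb : Function.Bijective (CubeHeat.Idm N), ∀ f : CubeHeat.domA N,
      ∃ ℓ : CubeHeat.Hm1cube N, CubeHeat.IsDistribLaplacian (f : CubeHeat.L2 N) ℓ ∧
        CubeHeat.opA f = -(LinearEquiv.ofBijective (CubeHeat.Idm N) hb).symm ℓ := by
  refine ⟨CubeHeat.existsUnique_isPotential, fun f hf => ?_, CubeHeat.domA_eq hN,
    CubeHeat.bijective_Idm hN, fun f => ?_⟩
  · obtain ⟨g, hg⟩ := hf.2
    exact ⟨g, hg, fun g' hg' => CubeHeat.represents_unique hg' hg⟩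
  · refine ⟨-(CubeHeat.Idm N (CubeHeat.opA f)),
      CubeHeat.isDistribLaplacian_of_represents f.2.2.choose_spec, ?_⟩
    rw [map_neg]
    exact ((congrArg (fun g => - -g)
      ((LinearEquiv.ofBijective _ (CubeHeat.bijective_Idm hN)).symm_apply_apply
        (CubeHeat.opA f))).trans (neg_neg (CubeHeat.opA f))).symm
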